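/- Let $T>0$, let $X$ be a compact metrizable space (for instance a compact subset of $\mathbb R^n$), let $p\in C(X)$, let $\varepsilon\in(0,1]$, and let $\mu_0$ be a Borel probability measure on $X$. Let $\mathcal L:\mathcal C\to C([0,T]\times X)$ be a linear operator with domain a linear subspace $\mathcal C=\operatorname{dom}(\mathcal L)\subseteq C([0,T]\times X)$, such that the functions $1$ and $t$ belong to $\mathcal C$ with $\mathcal L 1=0$ and $\mathcal L t=1$ (as is the case for the generator of a stochastic process on $[0,T]\times X$). Write $\mathcal M_+(S)$ for the finite nonnegative Borel measures on $S$, $\langle f,\mu\rangle=\int f\,d\mu$, and $p_\#\mu_\tau$ for the pushforward of $\mu_\tau$ under $(t,x)\mapsto p(x)$. Consider the expected-shortfall (ES) linear program in measures $$ p^*_c=\sup\Big\{\langle \mathrm{id}_{\mathbb R},\nu\rangle :\ \begin{array}{l} \mu,\mu_\tau\in\mathcal M_+([0,T]\times X),\ \nu,\hat\nu\in\mathcal M_+(\mathbb R),\\ \langle v,\mu_\tau\rangle=\langle v(0,\cdot),\mu_0\rangle+\langle\mathcal L v,\mu\rangle\ \ \forall v\in\mathcal C,\\ \langle 1,\nu\rangle=1,\quad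 \varepsilon\nu+\hat\nu=p_\#\mu_\tau \end{array}\Big\} $$ and the linear program in functions $$ d^*_c=\inf\Big\{u+\langle v(0,\cdot),\mu_0\rangle :\ \begin{array}{l} u\in\mathbb R,\ v\in\mathcal C,\ w\in C(\mathbb R),\\ \mathcal L v\le 0\ \text{ and }\ v(t,x)\ge w(p(x))\ \text{ on }[0,T]\times X,\\ u+\varepsilon w\ge \mathrm{id}_{\mathbb R}\ \text{ and }\ w\ge 0\ \text{ on }\mathbb R \end{array}\Big\}. $$ Then the second program is the (Lagrangian) dual of the first: for all $u\in\mathbb R$, $v\in\mathcal C$, $w\in C(\mathbb R)$, the supremum over $\mu,\mu_\tau\in\mathcal M_+([0,T]\times X)$ and compactly supported $\nu,\hat\nu\in\mathcal M_+(\mathbb R)$ of $$ \langle \mathrm{id}_{\mathbb R},\nu\rangle+u\,(1-\langle 1,\nu\rangle)+\big(\langle v(0,\cdot),\mu_0\rangle+\langle\mathcal Lv,\mu\rangle-\langle v,\mu_\tau\rangle\big)+\big(\langle w\circ p,\mu_\tau\rangle-\varepsilon\langle w,\nu\rangle-\langle w,\hat\nu\rangle\big) $$ equals $u+\langle v(0,\cdot),\mu_0\rangle$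 if $(u,v,w)$ is feasible for the second program, and $+\infty$ otherwise. Moreover, strong duality holds: $d^*_c=p^*_c$. -/

import Mathlib

open MeasureTheory Set

noncomputable section

namespace PeakES

variable {X : Type*} [TopologicalSpace X]

/-- The coordinate function `(t, x) ↦ t` in `C([0,T] × X)`. -/
def timeFn (T : ℝ) : C(Icc (0 : ℝ) T × X, ℝ) where
  toFun z := (z.1 : ℝ)
  continuous_toFun := by fun_prop

/-- The initial slice `v(0, ·) ∈ C(X)` of `v ∈ C([0,T] × X)`. -/
def initialSlice {T : ℝ} (hT : 0 < T) (v : C(Icc (0 : ℝ) T × X, ℝ)) : C(X, ℝ) where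
  toFun x := v (⟨0, le_refl 0, hT.le⟩, x)
  continuous_toFun := by fun_prop

variable [MeasurableSpace X]

/-- Feasibility of `(μ_τ, μ, ν, ν̂)` in the measure program. All measures are finite nonnegative
Borel measures. The field `flow` is `μ_τ = δ₀ ⊗ μ₀ + L† μ`, tested on every `v ∈ dom L`. -/
structure IsPrimalFeasible {T : ℝ} (hT : 0 < T)
    (L : C(Icc (0 : ℝ) T × X, ℝ) →ₗ.[ℝ] C(Icc (0 : ℝ) T × X, ℝ))
    (μ₀ : Measure X) (p : C(X, ℝ)) (ε : ℝ)
    (μτ μ : Measure (Icc (0 : ℝ) T × X)) (ν νhat : Measure ℝ) : Prop where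
  finite_μτ : IsFiniteMeasure μτ
  finite_μ : IsFiniteMeasure μ
  finite_ν : IsFiniteMeasure ν
  finite_νhat : IsFiniteMeasure νhat
  flow : ∀ v : L.domain,
    ∫ z, (v : C(Icc (0 : ℝ) T × X, ℝ)) z ∂μτ = ∫ x, initialSlice hT v x ∂μ₀ + ∫ z, L v z ∂μ
  mass : ν univ = 1
  domination : ENNReal.ofReal ε • ν + νhat = μτ.map (fun z => p z.2)

/-- The optimal value `p*_c` of the measure program, in the extended reals. (For a feasible point
`ν ≤ ε⁻¹ p_# μ_τ` has compact support when `X` is compact, so that the identity is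
`ν`-integrable.) -/
def primalValue {T : ℝ} (hT : 0 < T)
    (L : C(Icc (0 : ℝ) T × X, ℝ) →ₗ.[ℝ] C(Icc (0 : ℝ) T × X, ℝ))
    (μ₀ : Measure X) (p : C(X, ℝ)) (ε : ℝ) : EReal :=
  sSup {r : EReal | ∃ (μτ μ : Measure (Icc (0 : ℝ) T × X)) (ν νhat : Measure ℝ),
    IsPrimalFeasible hT L μ₀ p ε μτ μ ν νhat ∧ r = ((∫ s, s ∂ν : ℝ) : EReal)}

/-- Feasibility of `(u, v, w)` in the function program. -/
structure IsDualFeasible {T : ℝ}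
    (L : C(Icc (0 : ℝ) T × X, ℝ) →ₗ.[ℝ] C(Icc (0 : ℝ) T × X, ℝ))
    (p : C(X, ℝ)) (ε : ℝ) (u : ℝ) (v : L.domain) (w : C(ℝ, ℝ)) : Prop where
  generator_nonpos : ∀ z, L v z ≤ 0
  terminal : ∀ z, w (p z.2) ≤ (v : C(Icc (0 : ℝ) T × X, ℝ)) z
  shortfall : ∀ s : ℝ, s ≤ u + ε * w s
  nonneg : ∀ s : ℝ, 0 ≤ w s

/-- The objective `u + ⟨v(0,·), μ₀⟩` of the function program. -/
def dualObjective {T : ℝ} (hT : 0 < T) (μ₀ : Measure X) (u : ℝ)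
    (v : C(Icc (0 : ℝ) T × X, ℝ)) : ℝ :=
  u + ∫ x, initialSlice hT v x ∂μ₀

/-- The optimal value `d*_c` of the function program, in the extended reals. -/
def dualValue {T : ℝ} (hT : 0 < T)
    (L : C(Icc (0 : ℝ) T × X, ℝ) →ₗ.[ℝ] C(Icc (0 : ℝ) T × X, ℝ))
    (μ₀ : Measure X) (p : C(X, ℝ)) (ε : ℝ) : EReal :=
  sInf {r : EReal | ∃ (u : ℝ) (v : L.domain) (w : C(ℝ, ℝ)),
    IsDualFeasible L p ε u v w ∧ r = (dualObjective hT μ₀ u v : EReal)}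

/-- The Lagrangian of the measure program: the objective plus the pairings of the multipliers
`u`, `v`, `w` with the residuals of the constraints `mass`, `flow`, `domination`. -/
def lagrangian {T : ℝ} (hT : 0 < T)
    (L : C(Icc (0 : ℝ) T × X, ℝ) →ₗ.[ℝ] C(Icc (0 : ℝ) T × X, ℝ))
    (μ₀ : Measure X) (p : C(X, ℝ)) (ε : ℝ)
    (μτ μ : Measure (Icc (0 : ℝ) T × X)) (ν νhat : Measure ℝ)
    (u : ℝ) (v : L.domain) (w : C(ℝ, ℝ)) : ℝ :=
  ∫ s, s ∂ν
    + u * (1 - ∫ _s, (1 : ℝ) ∂ν)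
    + (∫ x, initialSlice hT v x ∂μ₀ + ∫ z, L v z ∂μ
        - ∫ z, (v : C(Icc (0 : ℝ) T × X, ℝ)) z ∂μτ)
    + (∫ z, w (p z.2) ∂μτ - ε * ∫ s, w s ∂ν - ∫ s, w s ∂νhat)

/-- The Lagrange dual function: the supremum of the Lagrangian over all finite nonnegative Borel
measures. The measures on `ℝ` are compactly supported, so that their pairings with `id` and with
an arbitrary `w ∈ C(ℝ)` are defined. -/
def lagrangeDualFunction {T : ℝ} (hT : 0 < T)
    (L : C(Icc (0 : ℝ) T × X, ℝ) →ₗ.[ℝ] C(Icc (0 : ℝ) T × X, ℝ))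
    (μ₀ : Measure X) (p : C(X, ℝ)) (ε : ℝ) (u : ℝ) (v : L.domain) (w : C(ℝ, ℝ)) : EReal :=
  sSup {r : EReal | ∃ (μτ μ : Measure (Icc (0 : ℝ) T × X)) (ν νhat : Measure ℝ),
    IsFiniteMeasure μτ ∧ IsFiniteMeasure μ ∧ IsFiniteMeasure ν ∧ IsFiniteMeasure νhat ∧
    (∃ K : Set ℝ, IsCompact K ∧ ν Kᶜ = 0) ∧ (∃ K : Set ℝ, IsCompact K ∧ νhat Kᶜ = 0) ∧
    r = (lagrangian hT L μ₀ p ε μτ μ ν νhat u v w : EReal)}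

end PeakES

end

open MeasureTheory Set

namespace PeakES

/-! Weak duality is integration of the function constraints against the measures. For the converse,
the least `w` for a given `u` is `(s - u)⁺ / ε`, so `w` can be eliminated: what remains is `L v ≤
0`, `v ≥ 0`, `p ≤ u + ε v`. Multiplying `p` by a new variable `c` makes this system conic, and a
lower bound `d` for the function program (with `d ≥ ∫ p ∂μ₀`) becomes nonnegativity of `u + ⟨v(0,·),
μ₀⟩ - c d` on the resulting cone (`objectiveMap_nonneg`).

The function `1 + T - t` supplies a Slater point, so the algebraic Farkas lemma
`exists_nonneg_functional_comp_eq` applies without any closedness argument. It gives a positive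
functional on three copies of `C([0,T] × X)`, which Riesz–Markov turns into measures `μ`, `σ`, `ρ`.
Then `μτ = ε ρ + σ`, `ν = p_# ρ`, `νhat = p_# σ` is feasible with value exactly `d`. Taking `d` to
be the dual value closes the gap, and the measure program attains its supremum. -/

/-! ### Positive functionals: extension and representation. -/

/-- **Farkas' lemma** under an interior-point condition: a linear functional `φ` that is nonnegative
on the preimage of a cone under `B` factors through `B` by a functional nonnegative on the cone. -/
theorem exists_nonneg_functional_comp_eq {D F : Type*} [AddCommGroup D] [Module ℝ D]
    [AddCommGroup F] [Module ℝ F] (K : PointedCone ℝ F) (B : D →ₗ[ℝ] F) (φ : D →ₗ[ℝ] ℝ)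
    (hφ : ∀ x, B x ∈ K → 0 ≤ φ x) (hB : ∀ y, ∃ x, B x + y ∈ K) :
    ∃ h : F →ₗ[ℝ] ℝ, (∀ y ∈ K, 0 ≤ h y) ∧ ∀ x, h (B x) = φ x := by
  -- M. Riesz extension of `φ`, placed on `D × 0`, along the cone `B x + y ∈ K`; `hB` is its
  -- cofinality condition.
  let s : PointedCone ℝ (D × F) := K.comap (B.coprod LinearMap.id)
  have hs : ∀ z : D × F, z ∈ s ↔ B z.1 + z.2 ∈ K := fun z => by simp [s]
  let f : (D × F) →ₗ.[ℝ] ℝ :=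
    { domain := LinearMap.range (LinearMap.inl ℝ D F)
      toFun := (φ.comp (LinearMap.fst ℝ D F)).comp (Submodule.subtype _) }
  obtain ⟨g, hgf, hgs⟩ := riesz_extension s f
    (by
      rintro ⟨_, x, rfl⟩ hx
      refine hφ x ?_
      simpa [hs] using hx)
    (by
      rintro ⟨x', y⟩
      obtain ⟨x, hx⟩ := hB (B x' + y)
      refine ⟨⟨_, x, rfl⟩, ?_⟩
      rw [hs]
      simpa [add_assoc] using hx)
  have hg0 : ∀ x, g (x, 0) = φ x := fun x => hgf ⟨_, x, rfl⟩
  -- The vectors `(x, -B x)` form a subspace inside the cone, so `g` vanishes on them.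
  have hker : ∀ x, 0 ≤ g (x, -B x) := fun x => hgs _ (by rw [hs]; simp)
  refine ⟨g.comp (LinearMap.inr ℝ D F), fun y hy => hgs _ (by rw [hs]; simpa using hy), ?_⟩
  intro x
  have h1 := hker x
  have h2 := hker (-x)
  have e1 : g (x, -B x) = g (x, 0) - g (0, B x) := by rw [← map_sub]; simp
  have e2 : g (-x, -B (-x)) = -(g (x, 0) - g (0, B x)) := by
    rw [← e1, map_neg B, ← map_neg g, Prod.neg_mk]
  rw [e1, hg0] at h1
  rw [e2, hg0] at h2
  simp only [LinearMap.comp_apply, LinearMap.inr_apply]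
  linarith

/-- Riesz–Markov–Kakutani on a compact space: a positive functional on `C(Z)` is integration
against a finite measure. -/
theorem exists_measure_integral_eq {Z : Type*} [TopologicalSpace Z] [T2Space Z] [CompactSpace Z]
    [MeasurableSpace Z] [BorelSpace Z] (Λ : C(Z, ℝ) →ₗ[ℝ] ℝ) (hΛ : ∀ f, 0 ≤ f → 0 ≤ Λ f) :
    ∃ μ : Measure Z, IsFiniteMeasure μ ∧ ∀ f : C(Z, ℝ), ∫ z, f z ∂μ = Λ f := by
  let Λ' : CompactlySupportedContinuousMap Z ℝ →ₗ[ℝ] ℝ :=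
    { toFun := fun f => Λ f.toContinuousMap
      map_add' := fun f g => Λ.map_add f.toContinuousMap g.toContinuousMap
      map_smul' := fun c f => Λ.map_smul c f.toContinuousMap }
  let P : CompactlySupportedContinuousMap Z ℝ →ₚ[ℝ] ℝ :=
    PositiveLinearMap.mk₀ Λ' fun f hf => hΛ _ fun z => hf z
  exact ⟨RealRMK.rieszMeasure P, inferInstance, fun f =>
    RealRMK.integral_rieszMeasure P (CompactlySupportedContinuousMap.continuousMapEquiv f)⟩

theorem integrable_of_compact_support {ν : Measure ℝ} [IsFiniteMeasure ν] {K : Set ℝ}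
    (hK : IsCompact K) (hν : ν Kᶜ = 0) {f : ℝ → ℝ} (hf : Continuous f) : Integrable f ν := by
  have h := hf.continuousOn.integrableOn_compact (μ := ν) hK
  rwa [IntegrableOn, Measure.restrict_eq_self_of_ae_mem (mem_ae_iff.2 hν)] at h

/-- Used with `k` the weight of a Dirac mass at a point where a constraint fails by `a`. -/
theorem sSup_eq_top_of_affine_mem {S : Set EReal} {a b : ℝ} (ha : 0 < a)
    (h : ∀ k : ℝ, 0 ≤ k → ((b + k * a : ℝ) : EReal) ∈ S) : sSup S = ⊤ := by
  rw [EReal.eq_top_iff_forall_lt]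
  intro y
  refine lt_of_lt_of_le ?_ (le_sSup (h ((|y - b| + 1) / a) (by positivity)))
  rw [div_mul_cancel₀ _ ha.ne', EReal.coe_lt_coe_iff]
  linarith [le_abs_self (y - b)]

/-- Integration of the initial slice against `μ₀`, as a linear functional. -/
noncomputable def initialPairing {X : Type*} [TopologicalSpace X] [CompactSpace X] [MeasurableSpace X]
    [OpensMeasurableSpace X] {T : ℝ} (hT : 0 < T) (μ₀ : Measure X) [IsFiniteMeasure μ₀] :
    C(Icc (0 : ℝ) T × X, ℝ) →ₗ[ℝ] ℝ where
  toFun v := ∫ x, initialSlice hT v x ∂μ₀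
  map_add' v w := integral_add
    ((initialSlice hT v).continuous.integrable_of_hasCompactSupport
      (HasCompactSupport.of_compactSpace _))
    ((initialSlice hT w).continuous.integrable_of_hasCompactSupport
      (HasCompactSupport.of_compactSpace _))
  map_smul' c v := integral_const_mul c (fun x => initialSlice hT v x)

theorem initialPairing_apply {X : Type*} [TopologicalSpace X] [CompactSpace X] [MeasurableSpace X]
    [OpensMeasurableSpace X] {T : ℝ} (hT : 0 < T) (μ₀ : Measure X) [IsFiniteMeasure μ₀]
    (v : C(Icc (0 : ℝ) T × X, ℝ)) :
    initialPairing hT μ₀ v = ∫ x, initialSlice hT v x ∂μ₀ :=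
  rfl

theorem integrable_continuousMap {Z : Type*} [TopologicalSpace Z] [CompactSpace Z]
    [MeasurableSpace Z] [OpensMeasurableSpace Z] (μ : Measure Z) [IsFiniteMeasure μ]
    {f : Z → ℝ} (hf : Continuous f) : Integrable f μ :=
  hf.integrable_of_hasCompactSupport (HasCompactSupport.of_compactSpace _)

/-! ### The function program with `w` eliminated, and its Slater point. -/

section Domain

variable {X : Type*} [TopologicalSpace X] {T : ℝ}
  {L : C(Icc (0 : ℝ) T × X, ℝ) →ₗ.[ℝ] C(Icc (0 : ℝ) T × X, ℝ)} {p : C(X, ℝ)} {ε : ℝ}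

/-- The least admissible `w` for a given `u` is `s ↦ (s - u)⁺ / ε`. -/
theorem exists_isDualFeasible (hε : 0 < ε) {u : ℝ} {v : L.domain} (hL : ∀ z, L v z ≤ 0)
    (hv : ∀ z, 0 ≤ (v : C(Icc (0 : ℝ) T × X, ℝ)) z)
    (hp : ∀ z : Icc (0 : ℝ) T × X, p z.2 ≤ u + ε * (v : C(Icc (0 : ℝ) T × X, ℝ)) z) :
    ∃ w, IsDualFeasible L p ε u v w := by
  refine ⟨⟨fun s => max (s - u) 0 / ε, by fun_prop⟩, hL, fun z => ?_, fun s => ?_, fun s => ?_⟩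
  · change max (p z.2 - u) 0 / ε ≤ _
    rw [div_le_iff₀ hε]
    refine max_le ?_ (mul_nonneg (hv z) hε.le)
    linarith [hp z, mul_comm ε ((v : C(Icc (0 : ℝ) T × X, ℝ)) z)]
  · change s ≤ u + ε * (max (s - u) 0 / ε)
    rw [mul_div_cancel₀ _ hε.ne']
    linarith [le_max_left (s - u) 0]
  · exact div_nonneg (le_max_right _ _) hε.le

/-- The decreasing function `M (1 + T - t)` lies in the domain, with image `-M`. -/
theorem exists_strictly_decreasing (hL_one : ∃ h : (1 : C(Icc (0 : ℝ) T × X, ℝ)) ∈ L.domain,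
      L ⟨1, h⟩ = 0)
    (hL_time : ∃ h : (timeFn T : C(Icc (0 : ℝ) T × X, ℝ)) ∈ L.domain, L ⟨timeFn T, h⟩ = 1)
    {M : ℝ} (hM : 0 ≤ M) :
    ∃ v : L.domain, (∀ z, L v z = -M) ∧ ∀ z, M ≤ (v : C(Icc (0 : ℝ) T × X, ℝ)) z := by
  obtain ⟨h1, hL1⟩ := hL_one
  obtain ⟨h2, hL2⟩ := hL_time
  refine ⟨(M * (1 + T)) • ⟨1, h1⟩ - M • ⟨timeFn T, h2⟩, fun z => ?_, fun z => ?_⟩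
  · rw [LinearPMap.map_sub, LinearPMap.map_smul, LinearPMap.map_smul, hL1, hL2]
    simp
  · have : (z.1 : ℝ) ≤ T := z.1.2.2
    simp only [timeFn, Submodule.coe_sub, Submodule.coe_smul, ContinuousMap.sub_apply,
      ContinuousMap.smul_apply, ContinuousMap.one_apply, ContinuousMap.coe_mk, smul_eq_mul]
    nlinarith

/-- The constraints of the function program after elimination of `w`, homogenized by a third
variable: `(u, v, c) ↦ (-L v, v, u + ε v - c p)`. -/
noncomputable def constraintMap
    (L : C(Icc (0 : ℝ) T × X, ℝ) →ₗ.[ℝ] C(Icc (0 : ℝ) T × X, ℝ)) (p : C(X, ℝ)) (ε : ℝ) :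
    (ℝ × L.domain × ℝ) →ₗ[ℝ]
      (C(Icc (0 : ℝ) T × X, ℝ) × C(Icc (0 : ℝ) T × X, ℝ) × C(Icc (0 : ℝ) T × X, ℝ)) where
  toFun x := (-L x.2.1, x.2.1,
    x.1 • 1 + ε • (x.2.1 : C(Icc (0 : ℝ) T × X, ℝ)) - x.2.2 • p.comp ContinuousMap.snd)
  map_add' x y := by
    refine Prod.ext ?_ (Prod.ext ?_ ?_)
    · simp [LinearPMap.map_add, add_comm]
    · simp
    · ext z
      simp
      ring
  map_smul' c x := by
    refine Prod.ext ?_ (Prod.ext ?_ ?_)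
    · simp [LinearPMap.map_smul]
    · simp
    · ext z
      simp
      ring

theorem constraintMap_apply (u : ℝ) (v : L.domain) (c : ℝ) :
    constraintMap L p ε (u, v, c) = (-L v, (v : C(Icc (0 : ℝ) T × X, ℝ)),
      u • 1 + ε • (v : C(Icc (0 : ℝ) T × X, ℝ)) - c • p.comp ContinuousMap.snd) :=
  rfl

theorem mem_positive_prod_iff {Z : Type*} [TopologicalSpace Z] (a b c : C(Z, ℝ)) :
    (a, b, c) ∈ PointedCone.positive ℝ (C(Z, ℝ) × C(Z, ℝ) × C(Z, ℝ)) ↔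
      (∀ z, 0 ≤ a z) ∧ (∀ z, 0 ≤ b z) ∧ ∀ z, 0 ≤ c z := by
  rw [PointedCone.mem_positive, Prod.le_def, Prod.le_def]
  rfl

theorem constraintMap_mem_positive_iff (u : ℝ) (v : L.domain) (c : ℝ) :
    constraintMap L p ε (u, v, c) ∈ PointedCone.positive ℝ _ ↔
      (∀ z, L v z ≤ 0) ∧ (∀ z, 0 ≤ (v : C(Icc (0 : ℝ) T × X, ℝ)) z) ∧
      ∀ z : Icc (0 : ℝ) T × X, c * p z.2 ≤ u + ε * (v : C(Icc (0 : ℝ) T × X, ℝ)) z := by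
  rw [constraintMap_apply, mem_positive_prod_iff]
  simp

/-- The interior-point condition: every triple is moved into the positive cone by some value of
the constraint map. -/
theorem exists_constraintMap_add_mem_positive [CompactSpace X]
    (hL_one : ∃ h : (1 : C(Icc (0 : ℝ) T × X, ℝ)) ∈ L.domain, L ⟨1, h⟩ = 0)
    (hL_time : ∃ h : (timeFn T : C(Icc (0 : ℝ) T × X, ℝ)) ∈ L.domain, L ⟨timeFn T, h⟩ = 1)
    (hε : 0 < ε)
    (y : C(Icc (0 : ℝ) T × X, ℝ) × C(Icc (0 : ℝ) T × X, ℝ) × C(Icc (0 : ℝ) T × X, ℝ)) :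
    ∃ x, constraintMap L p ε x + y ∈ PointedCone.positive ℝ _ := by
  obtain ⟨y1, y2, y3⟩ := y
  have hM : 0 ≤ ‖y1‖ + ‖y2‖ + ‖y3‖ := by positivity
  have hn : ∀ (y : C(Icc (0 : ℝ) T × X, ℝ)) z, -‖y‖ ≤ y z := fun y z =>
    (abs_le.1 (y.norm_coe_le_norm z)).1
  obtain ⟨v, hv1, hv2⟩ := exists_strictly_decreasing hL_one hL_time hM
  -- With `c = 0`, each component of the image is at least the sum of the norms.
  refine ⟨(‖y1‖ + ‖y2‖ + ‖y3‖, v, 0), ?_⟩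
  rw [constraintMap_apply, Prod.mk_add_mk, Prod.mk_add_mk, mem_positive_prod_iff]
  refine ⟨fun z => ?_, fun z => ?_, fun z => ?_⟩
  · rw [ContinuousMap.add_apply, ContinuousMap.neg_apply, hv1]
    linarith [hn y1 z, norm_nonneg y2, norm_nonneg y3]
  · rw [ContinuousMap.add_apply]
    linarith [hn y2 z, hv2 z, norm_nonneg y1, norm_nonneg y3]
  · have := mul_nonneg hε.le (hM.trans (hv2 z))
    simp only [zero_smul, sub_zero, ContinuousMap.add_apply, ContinuousMap.smul_apply,
      ContinuousMap.one_apply, smul_eq_mul, mul_one]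
    linarith [hn y3 z, norm_nonneg y1, norm_nonneg y2]

end Domain

/-! ### Nonnegativity of the homogenized objective. -/

section Program

variable {X : Type*} [TopologicalSpace X] [CompactSpace X] [MeasurableSpace X] [BorelSpace X]
  {T : ℝ} {hT : 0 < T}
  {L : C(Icc (0 : ℝ) T × X, ℝ) →ₗ.[ℝ] C(Icc (0 : ℝ) T × X, ℝ)}
  {μ₀ : Measure X} {p : C(X, ℝ)} {ε : ℝ}

/-- Stopping immediately: any `(u, v)` with `0 ≤ v` and `a ≤ u + ε v` has objective at least
the mean of `a`. -/
theorem integral_le_add_initialPairing [IsProbabilityMeasure μ₀] (hε_le : ε ≤ 1)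
    {u : ℝ} {v : C(Icc (0 : ℝ) T × X, ℝ)} {a : X → ℝ} (ha : Continuous a) (hv : ∀ z, 0 ≤ v z)
    (hp : ∀ z, a z.2 ≤ u + ε * v z) : ∫ x, a x ∂μ₀ ≤ u + initialPairing hT μ₀ v := by
  have hi := integrable_continuousMap μ₀ (initialSlice hT v).continuous
  calc ∫ x, a x ∂μ₀ ≤ ∫ x, (u + initialSlice hT v x) ∂μ₀ := by
        refine integral_mono (integrable_continuousMap μ₀ ha) ((integrable_const u).add hi) ?_
        intro x
        -- At time `0`, `a ≤ u + ε v ≤ u + v` because `v ≥ 0` and `ε ≤ 1`.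
        have h0 := hv (⟨0, le_refl 0, hT.le⟩, x)
        have h1 := hp (⟨0, le_refl 0, hT.le⟩, x)
        change a x ≤ u + v (⟨0, le_refl 0, hT.le⟩, x)
        dsimp only at h1
        nlinarith
    _ = u + initialPairing hT μ₀ v := by
        rw [integral_add (integrable_const u) hi]
        simp [initialPairing_apply]

/-- The objective `u + ⟨v(0,·), μ₀⟩ - c d` of the homogenized function program. -/
noncomputable def objectiveMap (hT : 0 < T)
    (L : C(Icc (0 : ℝ) T × X, ℝ) →ₗ.[ℝ] C(Icc (0 : ℝ) T × X, ℝ)) (μ₀ : Measure X)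
    [IsFiniteMeasure μ₀] (d : ℝ) : (ℝ × L.domain × ℝ) →ₗ[ℝ] ℝ where
  toFun x := x.1 + initialPairing hT μ₀ x.2.1 - x.2.2 * d
  map_add' x y := by
    simp
    ring
  map_smul' c x := by
    simp
    ring

theorem objectiveMap_apply [IsFiniteMeasure μ₀] (d u : ℝ) (v : L.domain) (c : ℝ) :
    objectiveMap hT L μ₀ d (u, v, c) = u + initialPairing hT μ₀ v - c * d :=
  rfl

/-- For `c > 0`, dividing by `c` gives a feasible point of the function program. For `c ≤ 0`,
immediate stopping suffices, since `c d ≤ c ∫ p ∂μ₀`. -/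
theorem objectiveMap_nonneg [IsProbabilityMeasure μ₀] (hε : 0 < ε) (hε_le : ε ≤ 1) {d : ℝ}
    (hd : ∀ u v w, IsDualFeasible L p ε u v w → d ≤ dualObjective hT μ₀ u v)
    (hpd : ∫ x, p x ∂μ₀ ≤ d) (x : ℝ × L.domain × ℝ)
    (hx : constraintMap L p ε x ∈ PointedCone.positive ℝ _) : 0 ≤ objectiveMap hT L μ₀ d x := by
  obtain ⟨u, v, c⟩ := x
  obtain ⟨h1, h2, h3⟩ := (constraintMap_mem_positive_iff u v c).1 hx
  rw [objectiveMap_apply]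
  rcases le_or_gt c 0 with hc | hc
  · have := integral_le_add_initialPairing (hT := hT) (μ₀ := μ₀) hε_le
      (a := fun x => c * p x) (by fun_prop) h2 h3
    rw [integral_const_mul] at this
    nlinarith
  · have hc' := inv_pos.2 hc
    obtain ⟨w, hw⟩ := exists_isDualFeasible (L := L) (p := p) hε (u := c⁻¹ * u) (v := c⁻¹ • v)
      (fun z => by
        rw [LinearPMap.map_smul, ContinuousMap.smul_apply, smul_eq_mul]
        exact mul_nonpos_of_nonneg_of_nonpos hc'.le (h1 z))
      (fun z => mul_nonneg hc'.le (h2 z))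
      (fun z => by
        rw [Submodule.coe_smul, ContinuousMap.smul_apply, smul_eq_mul]
        have := mul_le_mul_of_nonneg_left (h3 z) hc'.le
        rw [inv_mul_cancel_left₀ hc.ne'] at this
        linarith)
    have h4 : d ≤ c⁻¹ * u + initialPairing hT μ₀ (c⁻¹ • (v : C(Icc (0 : ℝ) T × X, ℝ))) :=
      hd _ _ _ hw
    rw [map_smul, smul_eq_mul, ← mul_add, ← div_eq_inv_mul, le_div_iff₀ hc] at h4
    linarith

variable [TopologicalSpace.MetrizableSpace X]

/-! ### The Lagrange dual function. -/

/-- The Lagrangian, rearranged so that each measure is paired with one dual constraint. -/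
theorem lagrangian_eq {μτ μ : Measure (Icc (0 : ℝ) T × X)} {ν νhat : Measure ℝ}
    [IsFiniteMeasure μτ] [IsFiniteMeasure ν]
    {K : Set ℝ} (hK : IsCompact K) (hν : ν Kᶜ = 0) (u : ℝ) (v : L.domain) (w : C(ℝ, ℝ)) :
    lagrangian hT L μ₀ p ε μτ μ ν νhat u v w = dualObjective hT μ₀ u v
      + ∫ z, L v z ∂μ - ∫ z, ((v : C(Icc (0 : ℝ) T × X, ℝ)) z - w (p z.2)) ∂μτ
      - ∫ s, (u + ε * w s - s) ∂ν - ∫ s, w s ∂νhat := by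
  have i1 := integrable_of_compact_support hK hν continuous_id
  have i2 := integrable_of_compact_support hK hν w.continuous
  have i3 := integrable_continuousMap μτ (v : C(Icc (0 : ℝ) T × X, ℝ)).continuous
  have i4 : Integrable (fun z : Icc (0 : ℝ) T × X => w (p z.2)) μτ :=
    integrable_continuousMap μτ (by fun_prop)
  have e1 : ∫ s, (u + ε * w s - s) ∂ν = u * ∫ _s, (1 : ℝ) ∂ν + ε * ∫ s, w s ∂ν - ∫ s, s ∂ν := by
    have i5 : Integrable (fun s => u + ε * w s) ν := (integrable_const u).add (i2.const_mul ε)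
    have i6 : Integrable (fun s : ℝ => s) ν := i1
    rw [integral_sub i5 i6, integral_add (integrable_const u) (i2.const_mul ε),
      integral_const_mul, integral_const, integral_const, smul_eq_mul, smul_eq_mul]
    ring
  rw [e1, integral_sub i3 i4, lagrangian, dualObjective]
  ring

/-- Every measure term in `lagrangian_eq` is nonpositive, and the zero measures attain the bound. -/
theorem lagrangeDualFunction_of_feasible {u : ℝ} {v : L.domain} {w : C(ℝ, ℝ)}
    (h : IsDualFeasible L p ε u v w) :
    lagrangeDualFunction hT L μ₀ p ε u v w = (dualObjective hT μ₀ u v : EReal) := by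
  refine le_antisymm (sSup_le ?_) (le_sSup ?_)
  · rintro _ ⟨μτ, μ, ν, νhat, _, _, _, _, ⟨K, hK, hν⟩, -, rfl⟩
    rw [EReal.coe_le_coe_iff, lagrangian_eq hK hν]
    have h1 : ∫ z, L v z ∂μ ≤ 0 := integral_nonpos h.generator_nonpos
    have h2 : 0 ≤ ∫ z, ((v : C(Icc (0 : ℝ) T × X, ℝ)) z - w (p z.2)) ∂μτ :=
      integral_nonneg fun z => sub_nonneg.2 (h.terminal z)
    have h3 : 0 ≤ ∫ s, (u + ε * w s - s) ∂ν :=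
      integral_nonneg fun s => sub_nonneg.2 (h.shortfall s)
    have h4 : 0 ≤ ∫ s, w s ∂νhat := integral_nonneg h.nonneg
    linarith
  · refine ⟨0, 0, 0, 0, inferInstance, inferInstance, inferInstance, inferInstance,
      ⟨∅, isCompact_empty, rfl⟩, ⟨∅, isCompact_empty, rfl⟩, ?_⟩
    rw [lagrangian_eq isCompact_empty rfl]
    simp

theorem isFiniteMeasure_ofReal_smul {Ω : Type*} [MeasurableSpace Ω] (k : ℝ) (μ : Measure Ω)
    [IsFiniteMeasure μ] : IsFiniteMeasure (ENNReal.ofReal k • μ) :=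
  μ.smul_finite ENNReal.ofReal_ne_top

theorem lagrangeDualFunction_of_not_feasible {u : ℝ} {v : L.domain} {w : C(ℝ, ℝ)}
    (h : ¬ IsDualFeasible L p ε u v w) : lagrangeDualFunction hT L μ₀ p ε u v w = ⊤ := by
  have hcases : (∃ z, 0 < L v z) ∨ (∃ z, (v : C(Icc (0 : ℝ) T × X, ℝ)) z < w (p z.2)) ∨
      (∃ s : ℝ, u + ε * w s < s) ∨ ∃ s : ℝ, w s < 0 := by
    by_contra! hc
    exact h ⟨hc.1, hc.2.1, hc.2.2.1, hc.2.2.2⟩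
  have hempty : ∃ K : Set ℝ, IsCompact K ∧ (0 : Measure ℝ) Kᶜ = 0 := ⟨∅, isCompact_empty, rfl⟩
  have hdirac : ∀ (k s : ℝ), (ENNReal.ofReal k • Measure.dirac s) ({s} : Set ℝ)ᶜ = 0 := by simp
  have hfin : ∀ {Ω : Type _} [MeasurableSpace Ω] (k : ℝ) (a : Ω),
      IsFiniteMeasure (ENNReal.ofReal k • Measure.dirac a) :=
    fun k a => isFiniteMeasure_ofReal_smul k _
  have hfinR : ∀ k s : ℝ, IsFiniteMeasure (ENNReal.ofReal k • Measure.dirac s) :=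
    fun k a => isFiniteMeasure_ofReal_smul k _
  rcases hcases with ⟨z, hz⟩ | ⟨z, hz⟩ | ⟨s, hs⟩ | ⟨s, hs⟩
  · refine sSup_eq_top_of_affine_mem (b := dualObjective hT μ₀ u v) hz fun k hk =>
      ⟨0, ENNReal.ofReal k • Measure.dirac z, 0, 0, inferInstance, hfin k z, inferInstance,
        inferInstance, hempty, hempty, ?_⟩
    rw [lagrangian_eq isCompact_empty rfl]
    simp [integral_smul_measure, hk]
  · refine sSup_eq_top_of_affine_mem (b := dualObjective hT μ₀ u v) (sub_pos.2 hz) fun k hk =>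
      ⟨ENNReal.ofReal k • Measure.dirac z, 0, 0, 0, hfin k z, inferInstance, inferInstance,
        inferInstance, hempty, hempty, ?_⟩
    have := hfin k z
    rw [lagrangian_eq isCompact_empty rfl, integral_smul_measure, integral_dirac,
      ENNReal.toReal_ofReal hk, EReal.coe_eq_coe_iff]
    simp only [integral_zero_measure, smul_eq_mul]
    ring
  · refine sSup_eq_top_of_affine_mem (b := dualObjective hT μ₀ u v) (sub_pos.2 hs) fun k hk =>
      ⟨0, 0, ENNReal.ofReal k • Measure.dirac s, 0, inferInstance, inferInstance, hfinR k s,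
        inferInstance, ⟨{s}, isCompact_singleton, hdirac k s⟩, hempty, ?_⟩
    have := hfinR k s
    rw [lagrangian_eq isCompact_singleton (hdirac k s), integral_smul_measure, integral_dirac,
      ENNReal.toReal_ofReal hk, EReal.coe_eq_coe_iff]
    simp only [integral_zero_measure, smul_eq_mul]
    ring
  · refine sSup_eq_top_of_affine_mem (b := dualObjective hT μ₀ u v) (neg_pos.2 hs) fun k hk =>
      ⟨0, 0, 0, ENNReal.ofReal k • Measure.dirac s, inferInstance, inferInstance, inferInstance,
        hfinR k s, hempty, ⟨{s}, isCompact_singleton, hdirac k s⟩, ?_⟩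
    rw [lagrangian_eq isCompact_empty rfl, integral_smul_measure, integral_dirac,
      ENNReal.toReal_ofReal hk, EReal.coe_eq_coe_iff]
    simp only [integral_zero_measure, smul_eq_mul]
    ring

/-! ### Weak and strong duality. -/

theorem IsPrimalFeasible.integral_le_dualObjective (hε : 0 < ε)
    {μτ μ : Measure (Icc (0 : ℝ) T × X)} {ν νhat : Measure ℝ} {u : ℝ} {v : L.domain} {w : C(ℝ, ℝ)}
    (hP : IsPrimalFeasible hT L μ₀ p ε μτ μ ν νhat) (hD : IsDualFeasible L p ε u v w) :
    ∫ s, s ∂ν ≤ dualObjective hT μ₀ u v := by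
  have := hP.finite_μτ
  have := hP.finite_ν
  have hq : Measurable fun z : Icc (0 : ℝ) T × X => p z.2 := by fun_prop
  -- Continuous functions are integrable for `p_# μτ` since `X` is compact; as `ε > 0`, domination
  -- passes this to both `ν` and `νhat`.
  have hint : ∀ f : ℝ → ℝ, Continuous f → Integrable f ν ∧ Integrable f νhat := by
    intro f hf
    have h1 : Integrable f (μτ.map fun z => p z.2) := by
      rw [integrable_map_measure hf.aestronglyMeasurable hq.aemeasurable]
      exact integrable_continuousMap μτ (by fun_prop)
    rw [← hP.domination, integrable_add_measure,
      integrable_smul_measure (by simpa using hε) ENNReal.ofReal_ne_top] at h1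
    exact h1
  have hw := hint w w.continuous
  have hsplit : ε * ∫ s, w s ∂ν + ∫ s, w s ∂νhat = ∫ z, w (p z.2) ∂μτ := by
    rw [← integral_map hq.aemeasurable w.continuous.aestronglyMeasurable, ← hP.domination,
      integral_add_measure (hw.1.smul_measure ENNReal.ofReal_ne_top) hw.2, integral_smul_measure,
      ENNReal.toReal_ofReal hε.le, smul_eq_mul]
  have h1 : ∫ s, s ∂ν ≤ ∫ s, (u + ε * w s) ∂ν :=
    integral_mono (hint _ continuous_id).1 ((integrable_const u).add (hw.1.const_mul ε))
      hD.shortfall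
  rw [integral_add (integrable_const u) (hw.1.const_mul ε), integral_const_mul, integral_const,
    measureReal_def, hP.mass, ENNReal.toReal_one, one_smul] at h1
  have h2 : 0 ≤ ∫ s, w s ∂νhat := integral_nonneg hD.nonneg
  have h3 : ∫ z, w (p z.2) ∂μτ ≤ ∫ z, (v : C(Icc (0 : ℝ) T × X, ℝ)) z ∂μτ :=
    integral_mono (integrable_continuousMap μτ (by fun_prop))
      (integrable_continuousMap μτ (by fun_prop)) hD.terminal
  have h4 : ∫ z, L v z ∂μ ≤ 0 := integral_nonpos hD.generator_nonpos
  rw [hP.flow v] at h3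
  rw [dualObjective]
  linarith

/-- Multipliers for the function program: a lower bound `d` on its values is attained by a
feasible point of the measure program. -/
theorem exists_isPrimalFeasible_integral_eq
    (hL_one : ∃ h : (1 : C(Icc (0 : ℝ) T × X, ℝ)) ∈ L.domain, L ⟨1, h⟩ = 0)
    (hL_time : ∃ h : (timeFn T : C(Icc (0 : ℝ) T × X, ℝ)) ∈ L.domain, L ⟨timeFn T, h⟩ = 1)
    [IsProbabilityMeasure μ₀] (hε : 0 < ε) (hε_le : ε ≤ 1) {d : ℝ}
    (hd : ∀ u v w, IsDualFeasible L p ε u v w → d ≤ dualObjective hT μ₀ u v)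
    (hpd : ∫ x, p x ∂μ₀ ≤ d) :
    ∃ (μτ μ : Measure (Icc (0 : ℝ) T × X)) (ν νhat : Measure ℝ),
      IsPrimalFeasible hT L μ₀ p ε μτ μ ν νhat ∧ ∫ s, s ∂ν = d := by
  obtain ⟨h, hpos, hh⟩ := exists_nonneg_functional_comp_eq _ (constraintMap L p ε)
    (objectiveMap hT L μ₀ d) (objectiveMap_nonneg hε hε_le hd hpd)
    (exists_constraintMap_add_mem_positive hL_one hL_time hε)
  obtain ⟨μ, hμ, hμi⟩ := exists_measure_integral_eq (h.comp (LinearMap.inl ℝ _ _))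
    (fun f hf => hpos _ ((mem_positive_prod_iff _ _ _).2 ⟨hf, fun _ => le_rfl, fun _ => le_rfl⟩))
  obtain ⟨σ, hσ, hσi⟩ := exists_measure_integral_eq
    (h.comp ((LinearMap.inr ℝ _ _).comp (LinearMap.inl ℝ _ _)))
    (fun f hf => hpos _ ((mem_positive_prod_iff _ _ _).2 ⟨fun _ => le_rfl, hf, fun _ => le_rfl⟩))
  obtain ⟨ρ, hρ, hρi⟩ := exists_measure_integral_eq
    (h.comp ((LinearMap.inr ℝ _ _).comp (LinearMap.inr ℝ _ _)))
    (fun f hf => hpos _ ((mem_positive_prod_iff _ _ _).2 ⟨fun _ => le_rfl, fun _ => le_rfl, hf⟩))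
  have hdecomp : ∀ a b c : C(Icc (0 : ℝ) T × X, ℝ),
      h (a, b, c) = ∫ z, a z ∂μ + ∫ z, b z ∂σ + ∫ z, c z ∂ρ := by
    intro a b c
    rw [hμi, hσi, hρi]
    simp only [LinearMap.comp_apply, LinearMap.inl_apply, LinearMap.inr_apply, ← map_add]
    simp
  -- The variables `u`, `c`, `v` are tested one at a time, yielding the mass, the value and the flow
  -- equation.
  have hmass : ρ.real univ = 1 := by
    have := hh (1, 0, 0)
    rw [constraintMap_apply, objectiveMap_apply, hdecomp] at this
    simpa using this
  have hval : ∫ z, p z.2 ∂ρ = d := by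
    have := hh (0, 0, 1)
    rw [constraintMap_apply, objectiveMap_apply, hdecomp] at this
    simpa [integral_neg] using this
  have hflow : ∀ v : L.domain, -∫ z, L v z ∂μ + ∫ z, (v : C(Icc (0 : ℝ) T × X, ℝ)) z ∂σ
      + ε * ∫ z, (v : C(Icc (0 : ℝ) T × X, ℝ)) z ∂ρ = ∫ x, initialSlice hT v x ∂μ₀ := by
    intro v
    have := hh (0, v, 0)
    rw [constraintMap_apply, objectiveMap_apply, hdecomp, initialPairing_apply] at this
    simpa [integral_neg, integral_const_mul] using this
  have hq : Measurable fun z : Icc (0 : ℝ) T × X => p z.2 := by fun_prop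
  have hερ := isFiniteMeasure_ofReal_smul ε ρ
  refine ⟨ENNReal.ofReal ε • ρ + σ, μ, ρ.map (fun z => p z.2), σ.map (fun z => p z.2),
    ⟨inferInstance, hμ, inferInstance, inferInstance, fun v => ?_, ?_, ?_⟩, ?_⟩
  · rw [integral_add_measure (integrable_continuousMap _ (by fun_prop))
      (integrable_continuousMap _ (by fun_prop)), integral_smul_measure,
      ENNReal.toReal_ofReal hε.le, smul_eq_mul, ← hflow v]
    ring
  · rw [Measure.map_apply hq MeasurableSet.univ, preimage_univ]
    rwa [measureReal_def, ENNReal.toReal_eq_one_iff] at hmass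
  · rw [Measure.map_add _ _ hq, Measure.map_smul]
  · exact (integral_map hq.aemeasurable aestronglyMeasurable_id).trans hval

theorem dualValue_eq_primalValue
    (hL_one : ∃ h : (1 : C(Icc (0 : ℝ) T × X, ℝ)) ∈ L.domain, L ⟨1, h⟩ = 0)
    (hL_time : ∃ h : (timeFn T : C(Icc (0 : ℝ) T × X, ℝ)) ∈ L.domain, L ⟨timeFn T, h⟩ = 1)
    [IsProbabilityMeasure μ₀] (hε : 0 < ε) (hε_le : ε ≤ 1) :
    dualValue hT L μ₀ p ε = primalValue hT L μ₀ p ε := by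
  refine le_antisymm ?_ (sSup_le ?_)
  · have hlow : ((∫ x, p x ∂μ₀ : ℝ) : EReal) ≤ dualValue hT L μ₀ p ε := by
      refine le_sInf ?_
      rintro _ ⟨u, v, w, hD, rfl⟩
      exact EReal.coe_le_coe_iff.2 (integral_le_add_initialPairing hε_le p.continuous
        (fun z => (hD.nonneg _).trans (hD.terminal z))
        (fun z => (hD.shortfall _).trans (by
          linarith [mul_le_mul_of_nonneg_left (hD.terminal z) hε.le])))
    have htop : dualValue hT L μ₀ p ε ≠ ⊤ := by
      -- With `M = 0` this `v` has `L v = 0` and `v ≥ 0`, so the constant `u = ‖p‖` already meets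
      -- the constraint on `p`.
      obtain ⟨v, hv1, hv2⟩ := exists_strictly_decreasing hL_one hL_time (le_refl (0 : ℝ))
      obtain ⟨w, hw⟩ := exists_isDualFeasible (p := p) hε (u := ‖p‖) (v := v)
        (fun z => (hv1 z).le.trans (by simp)) hv2
        (fun z => by
          linarith [(abs_le.1 (p.norm_coe_le_norm z.2)).2, mul_nonneg hε.le (hv2 z)])
      exact ne_top_of_le_ne_top (EReal.coe_ne_top _) (sInf_le ⟨_, v, w, hw, rfl⟩)
    have hbot : dualValue hT L μ₀ p ε ≠ ⊥ := ne_bot_of_le_ne_bot (EReal.coe_ne_bot _) hlow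
    obtain ⟨d, hd⟩ : ∃ d : ℝ, (d : EReal) = dualValue hT L μ₀ p ε :=
      ⟨_, EReal.coe_toReal htop hbot⟩
    rw [← hd, EReal.coe_le_coe_iff] at hlow
    obtain ⟨μτ, μ, ν, νhat, hP, hval⟩ := exists_isPrimalFeasible_integral_eq hL_one hL_time hε hε_le
      (fun u v w hD => EReal.coe_le_coe_iff.1 (hd.le.trans (sInf_le ⟨u, v, w, hD, rfl⟩))) hlow
    rw [← hd, ← hval]
    exact le_sSup ⟨μτ, μ, ν, νhat, hP, rfl⟩
  · rintro _ ⟨μτ, μ, ν, νhat, hP, rfl⟩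
    refine le_sInf ?_
    rintro _ ⟨u, v, w, hD, rfl⟩
    exact EReal.coe_le_coe_iff.2 (hP.integral_le_dualObjective hε hD)

end Program

end PeakES

theorem mainTheorem5 {X : Type*} [TopologicalSpace X] [CompactSpace X]
    [TopologicalSpace.MetrizableSpace X] [MeasurableSpace X] [BorelSpace X]
    {T : ℝ} (hT : 0 < T)
    (L : C(Set.Icc (0 : ℝ) T × X, ℝ) →ₗ.[ℝ] C(Set.Icc (0 : ℝ) T × X, ℝ))
    (hL_one : ∃ h : (1 : C(Set.Icc (0 : ℝ) T × X, ℝ)) ∈ L.domain, L ⟨1, h⟩ = 0)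
    (hL_time : ∃ h : (PeakES.timeFn T : C(Set.Icc (0 : ℝ) T × X, ℝ)) ∈ L.domain,
      L ⟨PeakES.timeFn T, h⟩ = 1)
    (μ₀ : MeasureTheory.Measure X) [MeasureTheory.IsProbabilityMeasure μ₀]
    (p : C(X, ℝ)) (ε : ℝ) (hε_pos : 0 < ε) (hε_le : ε ≤ 1) :
    (∀ (u : ℝ) (v : L.domain) (w : C(ℝ, ℝ)),
      (PeakES.IsDualFeasible L p ε u v w →
        PeakES.lagrangeDualFunction hT L μ₀ p ε u v w
          = (PeakES.dualObjective hT μ₀ u v : EReal)) ∧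
      (¬ PeakES.IsDualFeasible L p ε u v w →
        PeakES.lagrangeDualFunction hT L μ₀ p ε u v w = ⊤)) ∧
    PeakES.dualValue hT L μ₀ p ε = PeakES.primalValue hT L μ₀ p ε :=
  ⟨fun _ _ _ => ⟨PeakES.lagrangeDualFunction_of_feasible,
      PeakES.lagrangeDualFunction_of_not_feasible⟩,
    PeakES.dualValue_eq_primalValue hL_one hL_time hε_pos hε_le⟩
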